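/- All manifolds and Lie groups are real, finite-dimensional, smooth, without boundary, Hausdorff and second countable. A (\(C^0\)-)Finsler metric on a manifold \(M\) is a continuous function \(F:TM\to\mathbb R\) whose restriction to every tangent space is a norm; its distance is \(d_F(x,y)=\inf_\gamma\int F(\gamma'(t))\,dt\), the infimum over piecewise \(C^1\) paths from \(x\) to \(y\) (\(\infty\) if there are none). Let \(\mathcal L(M)\) be the set of metrics \(d\) on \(M\) that induce the manifold topology and for which there is a Finsler metric \(F\) on \(M\) such that every \(p\in M\) has a neighborhood \(V\) and constants \(c,C>0\) with \(c\,d(x,y)\le d_F(x,y)\le C\,d(x,y)\) for all \(x,y\in V\). For an (extended) metric \(d\) on a set \(S\), the length of \(\gamma:[a,b]\to S\) is \(\ell_d(\gamma)=\sup\sum_i d(\gamma(t_{i-1}),\gamma(t_i))\), the supremum over all partitions \(a=t_0<\dots<t_n=b\), and the intrinsic metric induced by \(d\) is \(\hat d(x,y)=\inf_\gamma\ell_d(\gamma)\), the infimum over all \(d\)-continuous paths from \(x\) to \(y\) (\(\infty\) if there are none). **Theorem.** Let \(G\) be a Lie group with Lie algebra \(\mathfrak g\), let \(M\) be a manifold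 with a metric \(d\in\mathcal L(M)\), and let \(G\times M\to M\), \((g,p)\mapsto gp\), be a smooth left action such that \(d(gx,gy)=d(x,y)\) for all \(g\in G\), \(x,y\in M\). Let \(X\subset M\) be compact, let \(H_X=\{g\in G: gX=X\}\), and let \(d_X\) be the induced Hausdorff metric on \(G/H_X\), that is, \(d_X(gH_X,hH_X)=d_H(gX,hX)\), where \(d_H\) is the Hausdorff distance of \((M,d)\). Let \(\hat d_X\) be the intrinsic metric induced by \(d_X\). For \(v\in\mathfrak g\) let \(\eta:\mathbb R\to G/H_X\), \(\eta(t)=\exp(tv)H_X\). Then the following limits exist and \[ \lim_{t\to 0}\frac{d_X(\exp(tv)H_X,H_X)}{|t|} =\lim_{t\to 0}\frac{d_H(\exp(tv)X,X)}{|t|} =\lim_{t\to 0}\frac{\hat d_X(\exp(tv)H_X,H_X)}{|t|} =\ell_{d_X}(\eta|_{[0,1]}) =\ell_{\hat d_X}(\eta|_{[0,1]})<\infty . \] -/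

import Mathlib

open Set Filter Topology MeasureTheory
open scoped Manifold ContDiff ENNReal Pointwise

noncomputable section

/-- The exponential map of a real Lie group: `lieExp E v` is the value at time `1` of the integral
curve, starting at the identity and defined for all times, of the left-invariant vector field
whose value at the identity is `v`. (On a Lie group this curve exists and is unique; the other
branch only makes the definition total.) -/
def lieExp (E : Type*) [NormedAddCommGroup E] [NormedSpace ℝ E]
    {G : Type*} [TopologicalSpace G] [ChartedSpace E G] [Group G]
    (v : GroupLieAlgebra 𝓘(ℝ, E) G) : G :=
  open Classical in
  if h : ∃ γ : ℝ → G, γ 0 = 1 ∧ IsMIntegralCurve γ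
      (mulInvariantVectorField (I := 𝓘(ℝ, E)) (G := G) v) then
    h.choose 1
  else 1

/-- A (`C^0`-)Finsler metric: a continuous function on the tangent bundle whose restriction to
each tangent space is a norm. -/
structure FinslerMetric (E : Type*) [NormedAddCommGroup E] [NormedSpace ℝ E]
    (M : Type*) [TopologicalSpace M] [ChartedSpace E M] [IsManifold 𝓘(ℝ, E) ∞ M] where
  toFun : TangentBundle 𝓘(ℝ, E) M → ℝ
  continuous_toFun : Continuous toFun
  nonneg : ∀ (p : M) (v : TangentSpace 𝓘(ℝ, E) p), 0 ≤ toFun ⟨p, v⟩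
  eq_zero_iff : ∀ (p : M) (v : TangentSpace 𝓘(ℝ, E) p), toFun ⟨p, v⟩ = 0 ↔ v = 0
  map_smul : ∀ (p : M) (c : ℝ) (v : TangentSpace 𝓘(ℝ, E) p),
    toFun ⟨p, c • v⟩ = |c| * toFun ⟨p, v⟩
  add_le : ∀ (p : M) (v w : TangentSpace 𝓘(ℝ, E) p),
    toFun ⟨p, v + w⟩ ≤ toFun ⟨p, v⟩ + toFun ⟨p, w⟩

/-- `γ` is continuously differentiable by parts on `[a, b]`: there is a subdivision
`a = t 0 ≤ t 1 ≤ ... ≤ t n = b` such that `γ` is `C^1` on each closed piece. -/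
def IsPiecewiseC1On (E : Type*) [NormedAddCommGroup E] [NormedSpace ℝ E]
    {M : Type*} [TopologicalSpace M] [ChartedSpace E M] (γ : ℝ → M) (a b : ℝ) : Prop :=
  ∃ (n : ℕ) (t : ℕ → ℝ), Monotone t ∧ t 0 = a ∧ t n = b ∧
    ∀ i < n, ContMDiffOn 𝓘(ℝ, ℝ) 𝓘(ℝ, E) 1 γ (Icc (t i) (t (i + 1)))

/-- The integral of `F (γ')` over `[a, b]`. -/
def FinslerMetric.pathLength {E : Type*} [NormedAddCommGroup E] [NormedSpace ℝ E]
    {M : Type*} [TopologicalSpace M] [ChartedSpace E M] [IsManifold 𝓘(ℝ, E) ∞ M]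
    (F : FinslerMetric E M) (γ : ℝ → M) (a b : ℝ) : ℝ≥0∞ :=
  ∫⁻ t in Icc a b, ENNReal.ofReal
    (F.toFun ⟨γ t, mfderiv 𝓘(ℝ, ℝ) 𝓘(ℝ, E) γ t (1 : ℝ)⟩)

/-- The distance function of a Finsler metric: the infimum of the integrals of `F (γ')` over the
paths `γ` from `x` to `y` that are continuously differentiable by parts. It is `∞` for points that
no path joins. -/
def FinslerMetric.edist {E : Type*} [NormedAddCommGroup E] [NormedSpace ℝ E]
    {M : Type*} [TopologicalSpace M] [ChartedSpace E M] [IsManifold 𝓘(ℝ, E) ∞ M]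
    (F : FinslerMetric E M) (x y : M) : ℝ≥0∞ :=
  ⨅ (a : ℝ) (b : ℝ) (γ : ℝ → M) (_ : a ≤ b) (_ : IsPiecewiseC1On E γ a b)
    (_ : γ a = x) (_ : γ b = y), F.pathLength γ a b

/-- The distance of the metric space `M` is locally Lipschitz equivalent to a Finsler metric of
the differentiable manifold `M`. (That the distance induces the manifold topology is built in: the
charts of `M` refer to the topology of the metric space.) -/
def IsLocallyLipschitzFinsler (E : Type*) [NormedAddCommGroup E] [NormedSpace ℝ E]
    (M : Type*) [MetricSpace M] [ChartedSpace E M] [IsManifold 𝓘(ℝ, E) ∞ M] : Prop :=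
  ∃ F : FinslerMetric E M, ∀ p : M, ∃ V ∈ 𝓝 p, ∃ c C : ℝ, 0 < c ∧ 0 < C ∧
    ∀ x ∈ V, ∀ y ∈ V,
      ENNReal.ofReal (c * dist x y) ≤ F.edist x y ∧
      F.edist x y ≤ ENNReal.ofReal (C * dist x y)

/-- The length of `γ` on `[a, b]` with respect to an extended distance `d`: the supremum of
`∑ d (γ (t i)) (γ (t (i + 1)))` over the partitions `a = t 0 ≤ t 1 ≤ ... ≤ t n = b`. -/
def curveLength {S : Type*} (d : S → S → ℝ≥0∞) (γ : ℝ → S) (a b : ℝ) : ℝ≥0∞ :=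
  ⨆ (n : ℕ) (t : ℕ → ℝ) (_ : Monotone t) (_ : t 0 = a) (_ : t n = b),
    ∑ i ∈ Finset.range n, d (γ (t i)) (γ (t (i + 1)))

/-- `γ` restricted to `[a, b]` is a `d`-path, i.e. continuous with respect to `d`. -/
def IsDistPathOn {S : Type*} (d : S → S → ℝ≥0∞) (γ : ℝ → S) (a b : ℝ) : Prop :=
  ∀ t ∈ Icc a b, Tendsto (fun s => d (γ s) (γ t)) (𝓝[Icc a b] t) (𝓝 0)

/-- The intrinsic (extended) metric induced by `d`: the infimum of the `d`-lengths of the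
`d`-paths from `x` to `y`. -/
def intrinsicDist {S : Type*} (d : S → S → ℝ≥0∞) (x y : S) : ℝ≥0∞ :=
  ⨅ (a : ℝ) (b : ℝ) (γ : ℝ → S) (_ : a ≤ b) (_ : IsDistPathOn d γ a b)
    (_ : γ a = x) (_ : γ b = y), curveLength d γ a b

/-- The induced Hausdorff metric on `G ⧸ H_X`, where `H_X` is the stabilizer of the set `X`:
the distance of `g H_X` and `h H_X` is the Hausdorff distance of `g • X` and `h • X`. -/
def inducedHausdorff (G : Type*) [Group G] {M : Type*} [MetricSpace M] [MulAction G M]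
    (X : Set M) (a b : G ⧸ MulAction.stabilizer G X) : ℝ≥0∞ :=
  Metric.hausdorffEDist (MulAction.ofQuotientStabilizer G X a)
    (MulAction.ofQuotientStabilizer G X b)

theorem inducedHausdorff_mk (G : Type*) [Group G] {M : Type*} [MetricSpace M] [MulAction G M]
    (X : Set M) (g h : G) :
    inducedHausdorff G X (g : G ⧸ MulAction.stabilizer G X) (h : G ⧸ MulAction.stabilizer G X)
      = Metric.hausdorffEDist (g • X) (h • X) := rfl

end

/-!
Along the one-parameter subgroup `exp (t v)`, the induced Hausdorff metric satisfies
`d_X (exp (s v) H_X, exp (t v) H_X) = φ (s - t)` with `φ t = d_H (exp (t v) X, X)`, because `G` acts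
by isometries and `t ↦ exp (t v)` is a homomorphism. The triangle inequality makes `φ` subadditive,
and symmetry makes it even.

If moreover `φ t ≤ C |t|` for small `t`, Fekete's argument at `0`
(`exists_tendsto_div_abs_of_subadditive`) gives the limit `L = lim φ t / |t|`, which is also the
supremum of these quotients. Hence the curve `η` is `L`-Lipschitz for `d_X`, so all its inscribed
sums on `[0, 1]` are at most `L`, and those of the uniform partitions tend to `L`: its length is `L`.
Its arcs are paths of length at most `L |t|`, so that `φ t ≤ d̂_X (η t, η 0) ≤ L |t|`, and the
intrinsic metric has the same limit and the same length of `η`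
(`exists_speed_of_homogeneous`).

Two facts remain. The first is that `lieExp` is a `C^1` homomorphism along lines: left-invariant
vector fields are complete, since left translation transports one local integral curve to every
point, and uniqueness of integral curves gives the homomorphism property
(`isMIntegralCurve_lieExp`, `lieExp_add_smul`, `contMDiff_lieExp_smul`). The second is the bound
`φ t ≤ C |t|`. The velocity of `t ↦ exp (t v) y` is continuous in `(t, y)`, so its Finsler norm is
bounded near each `(0, x)`. Integrating along the orbit bounds the Finsler distance of `exp (t v) y`
and `y`, the local Lipschitz equivalence transfers the bound to `d`, and compactness of `X` makes it
uniform (`IsLocallyLipschitzFinsler.exists_dist_le_mul_abs`).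
-/

/-! ### Subadditive functions on the line -/

theorem apply_natCast_mul_le_of_subadditive {R : Type*} [Semiring R] [PartialOrder R]
    [IsOrderedRing R] {f : ℝ → R} (hsub : ∀ s t, f (s + t) ≤ f s + f t) (h0 : f 0 = 0)
    (n : ℕ) (s : ℝ) : f (n * s) ≤ n * f s := by
  induction n with
  | zero => simp [h0]
  | succ k ih =>
    push_cast
    rw [add_mul, one_mul, add_mul, one_mul]
    exact (hsub _ _).trans (by gcongr)

/-- A linear bound near `0` on a subadditive function extends to the whole line, by cutting `t`
into equal small pieces; in particular the function is finite. -/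
theorem le_ofReal_mul_abs_of_subadditive {φ : ℝ → ℝ≥0∞} (hsub : ∀ s t, φ (s + t) ≤ φ s + φ t)
    (h0 : φ 0 = 0) {C ε : ℝ} (hε : 0 < ε)
    (hC : ∀ t, |t| < ε → φ t ≤ ENNReal.ofReal (C * |t|)) (t : ℝ) :
    φ t ≤ ENNReal.ofReal (C * |t|) := by
  obtain ⟨n, hn⟩ := exists_nat_gt (|t| / ε)
  have hn0 : (0 : ℝ) < n := (by positivity : (0 : ℝ) ≤ |t| / ε).trans_lt hn
  have hsmall : |t / n| < ε := by
    rw [abs_div, abs_of_pos hn0, div_lt_iff₀ hn0]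
    rw [div_lt_iff₀ hε] at hn
    linarith
  calc φ t = φ (n * (t / n)) := by rw [mul_div_cancel₀ _ hn0.ne']
    _ ≤ n * φ (t / n) := apply_natCast_mul_le_of_subadditive hsub h0 n _
    _ ≤ n * ENNReal.ofReal (C * |t / n|) := by gcongr; exact hC _ hsmall
    _ = ENNReal.ofReal (C * |t|) := by
      rw [← ENNReal.ofReal_natCast n, ← ENNReal.ofReal_mul hn0.le, abs_div, abs_of_pos hn0]
      congr 1
      field_simp

/-- Fekete's lemma at `0`: the quotients `f t / |t|` of an even subadditive function with
`f t ≤ C * |t|` converge to their supremum as `t → 0`. -/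
theorem exists_tendsto_div_abs_of_subadditive {f : ℝ → ℝ} (hsub : ∀ s t, f (s + t) ≤ f s + f t)
    (hnonneg : ∀ t, 0 ≤ f t) (heven : ∀ t, f (-t) = f t) {C : ℝ} (hC : ∀ t, f t ≤ C * |t|) :
    ∃ L : ℝ, 0 ≤ L ∧ (∀ t, f t ≤ L * |t|) ∧
      Tendsto (fun t => f t / |t|) (𝓝[≠] 0) (𝓝 L) := by
  have hbdd : BddAbove (range fun t => f t / |t|) := by
    refine ⟨max C 0, ?_⟩
    rintro _ ⟨t, rfl⟩
    rcases eq_or_ne t 0 with rfl | ht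
    · simp
    · exact ((div_le_iff₀ (abs_pos.2 ht)).2 (hC t)).trans (le_max_left _ _)
  set L : ℝ := ⨆ t, f t / |t| with hL
  have hle : ∀ t, f t / |t| ≤ L := fun t => le_ciSup hbdd t
  have habs : ∀ t, f |t| = f t := fun t => by
    rcases abs_choice t with h | h <;> rw [h]
    exact heven t
  refine ⟨L, by simpa using hle 0, fun t => ?_, ?_⟩
  · rcases eq_or_ne t 0 with rfl | ht
    · simpa using hC 0
    · exact (div_le_iff₀ (abs_pos.2 ht)).1 (hle t)
  refine tendsto_order.2 ⟨fun a ha => ?_, fun a ha =>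
    Eventually.of_forall fun t => (hle t).trans_lt ha⟩
  rcases lt_or_ge a 0 with ha0 | ha0
  · exact Eventually.of_forall fun t => ha0.trans_le (div_nonneg (hnonneg t) (abs_nonneg t))
  obtain ⟨t₀, ht₀⟩ := exists_lt_of_lt_ciSup ha
  have ht₀0 : t₀ ≠ 0 := by
    rintro rfl
    simp at ht₀
    linarith
  have hT : 0 < |t₀| := abs_pos.2 ht₀0
  rw [lt_div_iff₀ hT, ← habs] at ht₀
  generalize |t₀| = T at hT ht₀
  have hC0 : 0 ≤ C := by
    have := (hnonneg 1).trans (hC 1)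
    simpa using this
  -- Euclidean division `T = n * |s| + r` with `0 ≤ r < |s|` bounds `f T` by `n * f s + C * |s|`.
  have hsmall : ∀ᶠ s in 𝓝[≠] (0 : ℝ), C * |s| < f T - a * T := by
    have : Tendsto (fun s : ℝ => C * |s|) (𝓝 0) (𝓝 (C * |0|)) :=
      (continuous_const.mul continuous_abs).tendsto 0
    rw [abs_zero, mul_zero] at this
    exact (this.mono_left nhdsWithin_le_nhds).eventually (gt_mem_nhds (by linarith))
  filter_upwards [hsmall, self_mem_nhdsWithin] with s hs hs0
  have hσ : 0 < |s| := abs_pos.2 hs0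
  rw [lt_div_iff₀ hσ, ← habs s]
  generalize |s| = σ at hσ hs
  have hmul := apply_natCast_mul_le_of_subadditive hsub
    (le_antisymm (by simpa using hC 0) (hnonneg 0))
  have hn := Nat.floor_le (div_pos hT hσ).le
  have hn' := Nat.lt_floor_add_one (T / σ)
  set n := ⌊T / σ⌋₊
  rw [le_div_iff₀ hσ] at hn
  rw [div_lt_iff₀ hσ] at hn'
  have h1 : f T ≤ n * f σ + C * (T - n * σ) := by
    have h2 := hsub (n * σ) (T - n * σ)
    have h3 := hC (T - n * σ)
    rw [abs_of_nonneg (by linarith)] at h3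
    rw [add_sub_cancel] at h2
    linarith [hmul n σ]
  have h4 : C * (T - n * σ) ≤ C * σ := by gcongr; linarith
  have h5 : a * T < n * f σ := by linarith
  by_contra! hcon
  have h6 : (n : ℝ) * f σ ≤ n * (a * σ) := by gcongr
  have h7 : a * (n * σ) ≤ a * T := by gcongr
  linarith

/-! ### Lengths of homogeneous curves -/

section Length

variable {S : Type*} {d : S → S → ℝ≥0∞} {η : ℝ → S} {L : ℝ≥0∞} {a b : ℝ}

theorem curveLength_le_mul
    (h : ∀ s t, s ≤ t → d (η s) (η t) ≤ L * ENNReal.ofReal (t - s)) :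
    curveLength d η a b ≤ L * ENNReal.ofReal (b - a) := by
  refine iSup_le fun n => iSup_le fun t => iSup_le fun ht => iSup_le fun h0 => iSup_le fun hn => ?_
  calc ∑ i ∈ Finset.range n, d (η (t i)) (η (t (i + 1)))
      ≤ ∑ i ∈ Finset.range n, L * ENNReal.ofReal (t (i + 1) - t i) :=
        Finset.sum_le_sum fun i _ => h _ _ (ht i.le_succ)
    _ = L * ENNReal.ofReal (b - a) := by
        rw [← Finset.mul_sum, ← ENNReal.ofReal_sum_of_nonneg
          (fun i _ => sub_nonneg.2 (ht i.le_succ)), Finset.sum_range_sub, h0, hn]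

theorem dist_le_curveLength (d : S → S → ℝ≥0∞) (η : ℝ → S) (hab : a ≤ b) :
    d (η a) (η b) ≤ curveLength d η a b := by
  refine le_iSup_of_le 1 <| le_iSup_of_le (fun i => if i = 0 then a else b) <|
    le_iSup_of_le ?_ <| le_iSup_of_le (by simp) <| le_iSup_of_le (by simp) (by simp)
  intro i j hij
  rcases Nat.eq_zero_or_pos i with rfl | hi
  · by_cases hj : j = 0 <;> simp [hj, hab]
  · simp [hi.ne', (hi.trans_le hij).ne']

theorem le_intrinsicDist (d : S → S → ℝ≥0∞) (x y : S) : d x y ≤ intrinsicDist d x y := by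
  refine le_iInf fun a => le_iInf fun b => le_iInf fun γ => le_iInf fun hab => le_iInf fun _ =>
    le_iInf fun hx => le_iInf fun hy => ?_
  subst hx hy
  exact dist_le_curveLength d γ hab

theorem curveLength_mono {d' : S → S → ℝ≥0∞} (h : ∀ x y, d x y ≤ d' x y) :
    curveLength d η a b ≤ curveLength d' η a b := by
  unfold curveLength
  gcongr
  exact h _ _

theorem isDistPathOn_of_le_mul (hL : L ≠ ⊤)
    (h : ∀ s t, d (η s) (η t) ≤ L * ENNReal.ofReal |t - s|) : IsDistPathOn d η a b := by
  intro t _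
  have hlim : Tendsto (fun s => L * ENNReal.ofReal |t - s|) (𝓝 t) (𝓝 0) := by
    have h1 : Tendsto (fun s => ENNReal.ofReal |t - s|) (𝓝 t) (𝓝 0) := by
      have : Continuous fun s : ℝ => ENNReal.ofReal |t - s| 
          := ENNReal.continuous_ofReal.comp (by fun_prop)
      simpa using this.tendsto t
    simpa using ENNReal.Tendsto.const_mul h1 (Or.inr hL)
  exact tendsto_of_tendsto_of_tendsto_of_le_of_le tendsto_const_nhds
    (hlim.mono_left nhdsWithin_le_nhds) (fun _ => zero_le) (fun s => h s t)

/-- A curve that is `L`-Lipschitz for `d` is `L`-Lipschitz for the intrinsic metric: its arcs,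
run in either direction, are paths of length at most `L * |t - s|`. -/
theorem intrinsicDist_le_mul (hL : L ≠ ⊤)
    (h : ∀ s t, d (η s) (η t) ≤ L * ENNReal.ofReal |t - s|) (s t : ℝ) :
    intrinsicDist d (η s) (η t) ≤ L * ENNReal.ofReal |t - s| := by
  rcases le_total s t with hst | hts
  · rw [abs_of_nonneg (sub_nonneg.2 hst)]
    refine le_trans ?_ (curveLength_le_mul (d := d) (η := η) (a := s) (b := t) fun u w huw => ?_)
    · exact iInf_le_of_le s <| iInf_le_of_le t <| iInf_le_of_le η <| iInf_le_of_le hst <|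
        iInf_le_of_le (isDistPathOn_of_le_mul hL h) <| iInf_le_of_le rfl <| iInf_le_of_le rfl le_rfl
    · simpa [abs_of_nonneg (sub_nonneg.2 huw)] using h u w
  · have h' : ∀ u w, d (η (-u)) (η (-w)) ≤ L * ENNReal.ofReal |w - u| := fun u w => by
      simpa [abs_sub_comm, neg_add_eq_sub] using h (-u) (-w)
    have hst : -s ≤ -t := neg_le_neg hts
    have : |t - s| = -t - -s := by rw [abs_of_nonpos (sub_nonpos.2 hts)]; ring
    rw [this]
    refine le_trans ?_ (curveLength_le_mul (d := d) (η := fun u => η (-u)) (a := -s) (b := -t)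
      fun u w huw => ?_)
    · exact iInf_le_of_le (-s) <| iInf_le_of_le (-t) <| iInf_le_of_le (fun u => η (-u)) <|
        iInf_le_of_le hst <| iInf_le_of_le (isDistPathOn_of_le_mul (η := fun u => η (-u)) hL h') <|
        iInf_le_of_le (by simp) <| iInf_le_of_le (by simp) le_rfl
    · simpa [abs_of_nonneg (sub_nonneg.2 huw)] using h' u w

/-- Metric speed of a curve that is homogeneous for `d` (as are the orbits of a one-parameter group
of isometries) and Lipschitz near `0`. -/
theorem exists_speed_of_homogeneous (hself : ∀ x, d x x = 0) (hcomm : ∀ x y, d x y = d y x)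
    (htri : ∀ x y z, d x z ≤ d x y + d y z)
    (hhom : ∀ s t, d (η s) (η t) = d (η (s - t)) (η 0)) {C ε : ℝ} (hε : 0 < ε)
    (hC : ∀ t, |t| < ε → d (η t) (η 0) ≤ ENNReal.ofReal (C * |t|)) :
    ∃ L : ℝ≥0∞, L < ⊤ ∧
      Tendsto (fun t : ℝ => d (η t) (η 0) / ENNReal.ofReal |t|) (𝓝[≠] 0) (𝓝 L) ∧
      Tendsto (fun t : ℝ => intrinsicDist d (η t) (η 0) / ENNReal.ofReal |t|) (𝓝[≠] 0) (𝓝 L) ∧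
      curveLength d η 0 1 = L ∧ curveLength (intrinsicDist d) η 0 1 = L := by
  have hsub : ∀ s t, d (η (s + t)) (η 0) ≤ d (η s) (η 0) + d (η t) (η 0) := fun s t => by
    refine (htri _ (η t) _).trans_eq ?_
    rw [hhom (s + t) t, add_sub_cancel_right]
  have hbound := le_ofReal_mul_abs_of_subadditive (φ := fun t => d (η t) (η 0)) hsub
    (hself _) hε hC
  have hfin : ∀ t, d (η t) (η 0) ≠ ⊤ := fun t =>
    ne_top_of_le_ne_top ENNReal.ofReal_ne_top (hbound t)
  set f : ℝ → ℝ := fun t => (d (η t) (η 0)).toReal with hf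
  have hofReal : ∀ t, d (η t) (η 0) = ENNReal.ofReal (f t) := fun t =>
    (ENNReal.ofReal_toReal (hfin t)).symm
  have hfsub : ∀ s t, f (s + t) ≤ f s + f t := fun s t =>
    (ENNReal.toReal_mono (ENNReal.add_ne_top.2 ⟨hfin s, hfin t⟩) (hsub s t)).trans_eq
      (ENNReal.toReal_add (hfin s) (hfin t))
  have heven : ∀ t, f (-t) = f t := fun t => by
    simp only [hf]
    rw [hcomm (η t), hhom 0 t, zero_sub]
  have hfC : ∀ t, f t ≤ max C 0 * |t| := fun t =>
    ENNReal.toReal_le_of_le_ofReal (by positivity) ((hbound t).trans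
      (ENNReal.ofReal_le_ofReal (by gcongr; exact le_max_left _ _)))
  obtain ⟨L, hL0, hfL, hlim⟩ := exists_tendsto_div_abs_of_subadditive hfsub
    (fun t => ENNReal.toReal_nonneg) heven hfC
  have hdL : ∀ s t, d (η s) (η t) ≤ ENNReal.ofReal L * ENNReal.ofReal |t - s| := fun s t => by
    rw [hhom, hofReal, ← ENNReal.ofReal_mul hL0, abs_sub_comm]
    exact ENNReal.ofReal_le_ofReal (hfL _)
  have hIL := intrinsicDist_le_mul ENNReal.ofReal_ne_top hdL
  have hd : Tendsto (fun t : ℝ => d (η t) (η 0) / ENNReal.ofReal |t|) (𝓝[≠] 0)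
      (𝓝 (ENNReal.ofReal L)) := by
    refine (ENNReal.tendsto_ofReal hlim).congr' ?_
    filter_upwards [self_mem_nhdsWithin] with t ht
    rw [hofReal, ENNReal.ofReal_div_of_pos (abs_pos.2 ht)]
  have hlength : ENNReal.ofReal L ≤ curveLength d η 0 1 := by
    have hseq : Tendsto (fun n : ℕ => 1 / ((n : ℝ) + 1)) atTop (𝓝[≠] 0) :=
      tendsto_nhdsWithin_iff.2 ⟨tendsto_one_div_add_atTop_nhds_zero_nat,
        Eventually.of_forall fun n => by simpa using (Nat.cast_add_one_pos (α := ℝ) n).ne'⟩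
    refine le_of_tendsto' (hd.comp hseq) fun n => ?_
    have hn : (0 : ℝ) < (n : ℝ) + 1 := Nat.cast_add_one_pos n
    -- the partition of `[0, 1]` into `n + 1` equal pieces
    refine le_iSup_of_le (n + 1) <| le_iSup_of_le (fun i => (i : ℝ) * (1 / ((n : ℝ) + 1))) <|
      le_iSup_of_le ?_ <| le_iSup_of_le (by simp) <| le_iSup_of_le ?_ ?_
    · intro i j hij
      have : (i : ℝ) ≤ j := by exact_mod_cast hij
      dsimp only
      gcongr
    · push_cast
      field_simp
    · have hterm : ∀ i : ℕ, d (η (i * (1 / ((n : ℝ) + 1)))) (η ((i + 1 : ℕ) * (1 / ((n : ℝ) + 1))))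
          = d (η (1 / ((n : ℝ) + 1))) (η 0) := fun i => by
        rw [hcomm, hhom]
        congr 2
        push_cast
        ring
      simp only [hterm, Finset.sum_const, Finset.card_range, Function.comp_apply, nsmul_eq_mul]
      rw [abs_of_pos (by positivity), ENNReal.div_eq_inv_mul,
        ← ENNReal.ofReal_inv_of_pos (by positivity)]
      gcongr
      rw [one_div, inv_inv, ← Nat.cast_succ, ENNReal.ofReal_natCast]
  have hone : ENNReal.ofReal L * ENNReal.ofReal (1 - 0) = ENNReal.ofReal L := by simp
  have hupper : curveLength (intrinsicDist d) η 0 1 ≤ ENNReal.ofReal L := by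
    rw [← hone]
    refine curveLength_le_mul fun s t hst => ?_
    simpa [abs_of_nonneg (sub_nonneg.2 hst)] using hIL s t
  have hmono : curveLength d η 0 1 ≤ curveLength (intrinsicDist d) η 0 1 :=
    curveLength_mono (le_intrinsicDist d)
  refine ⟨ENNReal.ofReal L, ENNReal.ofReal_lt_top, hd, ?_, (hmono.trans hupper).antisymm hlength,
    hupper.antisymm (hlength.trans hmono)⟩
  refine tendsto_of_tendsto_of_tendsto_of_le_of_le' hd tendsto_const_nhds
    (Eventually.of_forall fun t => ENNReal.div_le_div_right (le_intrinsicDist d _ _) _) ?_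
  refine Eventually.of_forall fun t => ENNReal.div_le_of_le_mul ?_
  simpa using hIL t 0

end Length

/-! ### Integral curves and the exponential map -/

/-- An integral curve of a continuous vector field is continuously differentiable. -/
theorem IsMIntegralCurve.contMDiff_one {E : Type*} [NormedAddCommGroup E] [NormedSpace ℝ E]
    {M : Type*} [TopologicalSpace M] [ChartedSpace E M] [IsManifold 𝓘(ℝ, E) 1 M]
    {V : (x : M) → TangentSpace 𝓘(ℝ, E) x}
    (hV : Continuous (fun x => (⟨x, V x⟩ : TangentBundle 𝓘(ℝ, E) M))) {γ : ℝ → M}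
    (hγ : IsMIntegralCurve γ V) : ContMDiff 𝓘(ℝ, ℝ) 𝓘(ℝ, E) 1 γ := by
  intro t₀
  refine contMDiffAt_iff_target.2 ⟨hγ.continuous.continuousAt, ?_⟩
  rw [contMDiffAt_iff_contDiffAt, contDiffAt_one_iff]
  have hderiv := (hγ.isMIntegralCurveAt t₀).eventually_hasDerivAt
  let e := trivializationAt E (TangentSpace 𝓘(ℝ, E)) (γ t₀)
  have hbase : ∀ᶠ t in 𝓝 t₀, γ t ∈ e.baseSet :=
    hγ.continuous.continuousAt (e.open_baseSet.mem_nhds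
      (FiberBundle.mem_baseSet_trivializationAt' (γ t₀)))
  -- the trivialization at `γ t₀` turns the vector field along `γ` into the derivative of `γ` in the
  -- chart at `γ t₀`
  have hcoord : ContinuousOn (fun t => (e ⟨γ t, V (γ t)⟩).2) {t | γ t ∈ e.baseSet} := by
    refine continuous_snd.comp_continuousOn (e.continuousOn.comp
      (hV.comp hγ.continuous).continuousOn fun t ht => ?_)
    exact e.mem_source.2 ht
  refine ⟨fun t => ContinuousLinearMap.smulRight (1 : ℝ →L[ℝ] ℝ) (e ⟨γ t, V (γ t)⟩).2,
    _, inter_mem hderiv hbase, ?_, fun t ht => ?_⟩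
  · have := ((ContinuousLinearMap.smulRightL ℝ ℝ E (1 : ℝ →L[ℝ] ℝ)).continuous.comp_continuousOn
      hcoord)
    exact this.mono inter_subset_right
  · exact HasDerivAt.hasFDerivAt ht.1

section LieExp

variable {E : Type*} [NormedAddCommGroup E] [NormedSpace ℝ E]
  {G : Type*} [TopologicalSpace G] [ChartedSpace E G] [Group G] [LieGroup 𝓘(ℝ, E) ∞ G]

theorem contMDiff_mulInvariantVectorField_one (v : GroupLieAlgebra 𝓘(ℝ, E) G) :
    ContMDiff 𝓘(ℝ, E) 𝓘(ℝ, E).tangent 1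
      (fun g => (⟨g, mulInvariantVectorField v g⟩ : TangentBundle 𝓘(ℝ, E) G)) := by
  have : LieGroup 𝓘(ℝ, E) (minSmoothness ℝ 3) G := by
    rw [minSmoothness_of_isRCLikeNormedField]
    infer_instance
  refine (contMDiff_mulInvariantVectorField v).of_le ?_
  rw [minSmoothness_of_isRCLikeNormedField]
  norm_num

theorem mfderiv_mul_left_mulInvariantVectorField (g h : G) (v : GroupLieAlgebra 𝓘(ℝ, E) G) :
    mfderiv 𝓘(ℝ, E) 𝓘(ℝ, E) (g * ·) h (mulInvariantVectorField v h) =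
      mulInvariantVectorField v (g * h) := by
  have hdiff : ∀ a b : G, MDifferentiableAt 𝓘(ℝ, E) 𝓘(ℝ, E) (a * ·) b := fun a b =>
    (contMDiff_mul_left (I := 𝓘(ℝ, E)) (n := ∞) (a := a)).mdifferentiable (by simp) b
  have hcomp : (fun x : G => g * h * x) = (g * ·) ∘ (h * ·) := by
    ext x
    simp [mul_assoc]
  have := mfderiv_comp_apply_of_eq (x := (1 : G)) (y := h) (f := (h * ·)) (g := (g * ·))
    (hdiff g h) (hdiff h 1) (mul_one h) v
  simp only [mulInvariantVectorField]
  rw [hcomp]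
  exact this.symm

theorem IsMIntegralCurveOn.const_mul {v : GroupLieAlgebra 𝓘(ℝ, E) G} {γ : ℝ → G} {s : Set ℝ}
    (hγ : IsMIntegralCurveOn γ (mulInvariantVectorField v) s) (g : G) :
    IsMIntegralCurveOn (fun t => g * γ t) (mulInvariantVectorField v) s := by
  intro t ht
  have hdiff : MDifferentiableAt 𝓘(ℝ, E) 𝓘(ℝ, E) (g * ·) (γ t) :=
    (contMDiff_mul_left (I := 𝓘(ℝ, E)) (n := ∞) (a := g)).mdifferentiable (by simp) _
  have := hdiff.hasMFDerivAt.comp_hasMFDerivWithinAt t (hγ t ht)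
  refine this.congr_mfderiv (ContinuousLinearMap.ext fun (r : ℝ) => ?_)
  exact ((mfderiv 𝓘(ℝ, E) 𝓘(ℝ, E) (g * ·) (γ t)).map_smul r _).trans
    (congrArg (r • ·) (mfderiv_mul_left_mulInvariantVectorField g (γ t) v))

variable [FiniteDimensional ℝ E] [T2Space G]

/-- Left-invariant vector fields are complete: left translations carry an integral curve through
the identity to integral curves, with the same interval of existence, through every point. -/
theorem exists_isMIntegralCurve_mulInvariantVectorField (v : GroupLieAlgebra 𝓘(ℝ, E) G) :
    ∃ γ : ℝ → G, γ 0 = 1 ∧ IsMIntegralCurve γ (mulInvariantVectorField v) := by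
  have : CompleteSpace E := FiniteDimensional.complete ℝ E
  have hV := contMDiff_mulInvariantVectorField_one v
  obtain ⟨γ, h0, hγ⟩ := exists_isMIntegralCurveAt_of_contMDiffAt_boundaryless 0
    (hV.contMDiffAt (x := 1))
  obtain ⟨ε, hε, hγ⟩ := isMIntegralCurveAt_iff'.1 hγ
  rw [Real.ball_eq_Ioo, zero_sub, zero_add] at hγ
  exact exists_isMIntegralCurve_of_isMIntegralCurveOn hV hε
    (fun g => ⟨fun t => g * γ t, by simp [h0], hγ.const_mul g⟩) 1

/-- `t ↦ exp (t v)` is the integral curve through the identity of the left-invariant field of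
`v`. -/
theorem isMIntegralCurve_lieExp (v : GroupLieAlgebra 𝓘(ℝ, E) G) :
    (lieExp E ((0 : ℝ) • v) : G) = 1 ∧
      IsMIntegralCurve (fun t : ℝ => (lieExp E (t • v) : G)) (mulInvariantVectorField v) := by
  obtain ⟨γ, h0, hγ⟩ := exists_isMIntegralCurve_mulInvariantVectorField v
  have hexp : ∀ t : ℝ, (lieExp E (t • v) : G) = γ t := by
    intro t
    have h := exists_isMIntegralCurve_mulInvariantVectorField (G := G) (t • v)
    rw [lieExp, dif_pos h]
    have hscale := hγ.comp_mul t
    rw [← mulInvariantVectorField_smul] at hscale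
    have := isMIntegralCurve_Ioo_eq_of_contMDiff_boundaryless (t₀ := 0)
      (contMDiff_mulInvariantVectorField_one (t • v)) h.choose_spec.2 hscale
      (by simp [h.choose_spec.1, h0])
    rw [this]
    simp
  simp only [hexp]
  exact ⟨h0, hγ⟩

theorem lieExp_add_smul (v : GroupLieAlgebra 𝓘(ℝ, E) G) (s t : ℝ) :
    (lieExp E ((s + t) • v) : G) = lieExp E (s • v) * lieExp E (t • v) := by
  obtain ⟨h0, hγ⟩ := isMIntegralCurve_lieExp (G := G) v
  have hmul : IsMIntegralCurve (fun t : ℝ => (lieExp E (s • v) : G) * lieExp E (t • v))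
      (mulInvariantVectorField v) :=
    isMIntegralCurve_iff_isMIntegralCurveOn.2 ((hγ.isMIntegralCurveOn univ).const_mul _)
  have := isMIntegralCurve_Ioo_eq_of_contMDiff_boundaryless (t₀ := 0)
    (contMDiff_mulInvariantVectorField_one v) (hγ.comp_add s) hmul
    (by simp only [Function.comp_apply, zero_add, h0, mul_one])
  simpa [add_comm] using congrFun this t

theorem contMDiff_lieExp_smul (v : GroupLieAlgebra 𝓘(ℝ, E) G) :
    ContMDiff 𝓘(ℝ, ℝ) 𝓘(ℝ, E) 1 (fun t : ℝ => (lieExp E (t • v) : G)) :=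
  (isMIntegralCurve_lieExp v).2.contMDiff_one (contMDiff_mulInvariantVectorField_one v).continuous

end LieExp

/-! ### Displacement of points under a family of curves -/

section Finsler

variable {E : Type*} [NormedAddCommGroup E] [NormedSpace ℝ E]

/-- The velocity of the curves `s ↦ c (s, y)` depends continuously on `(s, y)`: it is the tangent
map of `c` applied to the vector `(1, 0)` at `(s, y)`. -/
theorem continuous_partial_velocity {M : Type*} [TopologicalSpace M] [ChartedSpace E M]
    [IsManifold 𝓘(ℝ, E) 1 M] {c : ℝ × M → M}
    (hc : ContMDiff (𝓘(ℝ, ℝ).prod 𝓘(ℝ, E)) 𝓘(ℝ, E) 1 c) :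
    Continuous fun q : ℝ × M => (⟨c q, mfderiv 𝓘(ℝ, ℝ) 𝓘(ℝ, E) (fun s => c (s, q.2)) q.1 (1 : ℝ)⟩ :
      TangentBundle 𝓘(ℝ, E) M) := by
  have hone : Continuous fun s : ℝ => (⟨s, (1 : ℝ)⟩ : TangentBundle 𝓘(ℝ, ℝ) ℝ) :=
    (tangentBundleModelSpaceHomeomorph 𝓘(ℝ, ℝ)).symm.continuous.comp
      (continuous_id.prodMk continuous_const)
  have hzero : Continuous fun y : M => (⟨y, 0⟩ : TangentBundle 𝓘(ℝ, E) M) :=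
    (Bundle.contMDiff_zeroSection (n := 0) (IB := 𝓘(ℝ, E)) ℝ
      (TangentSpace 𝓘(ℝ, E) : M → Type _)).continuous
  have hsec : Continuous fun q : ℝ × M => (equivTangentBundleProd 𝓘(ℝ, ℝ) ℝ 𝓘(ℝ, E) M).symm
      (⟨q.1, (1 : ℝ)⟩, ⟨q.2, 0⟩) :=
    (contMDiff_equivTangentBundleProd_symm (n := 0)).continuous.comp
      ((hone.comp continuous_fst).prodMk (hzero.comp continuous_snd))
  convert (hc.continuous_tangentMap le_rfl).comp hsec using 2 with q
  obtain ⟨s, y⟩ := q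
  have h1 : MDifferentiableAt (𝓘(ℝ, ℝ).prod 𝓘(ℝ, E)) 𝓘(ℝ, E) c (s, y) :=
    hc.mdifferentiable (by simp) _
  have h2 : MDifferentiableAt 𝓘(ℝ, ℝ) (𝓘(ℝ, ℝ).prod 𝓘(ℝ, E)) (fun u : ℝ => (u, y)) s :=
    mdifferentiableAt_id.prodMk mdifferentiableAt_const
  have h3 := mfderiv_comp_apply (x := s) (f := fun u : ℝ => (u, y)) (g := c) h1 h2 (1 : ℝ)
  rw [mfderiv_prod_left] at h3
  exact congrArg (Bundle.TotalSpace.mk (F := E) (c (s, y))) h3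

variable {M : Type*}

/-- Near `(0, x)` the Finsler speed of the curves `s ↦ c (s, y)` is bounded by continuity, so the
arcs of these curves bound the Finsler distance of their endpoints linearly in time. -/
theorem FinslerMetric.exists_edist_le [TopologicalSpace M] [ChartedSpace E M]
    [IsManifold 𝓘(ℝ, E) ∞ M] (F : FinslerMetric E M) {c : ℝ × M → M}
    (hc : ContMDiff (𝓘(ℝ, ℝ).prod 𝓘(ℝ, E)) 𝓘(ℝ, E) 1 c) (x : M) :
    ∃ B : ℝ, 0 < B ∧ ∃ ε > 0, ∃ U ∈ 𝓝 x, ∀ y ∈ U, ∀ s t, |s| < ε → |t| < ε → s ≤ t →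
      F.edist (c (s, y)) (c (t, y)) ≤ ENNReal.ofReal (B * (t - s)) := by
  have hcont := F.continuous_toFun.comp (continuous_partial_velocity hc)
  set σ : ℝ × M → ℝ := F.toFun ∘ fun q : ℝ × M =>
    (⟨c q, mfderiv 𝓘(ℝ, ℝ) 𝓘(ℝ, E) (fun s => c (s, q.2)) q.1 (1 : ℝ)⟩ :
      TangentBundle 𝓘(ℝ, E) M) with hσ
  have hB : 0 < σ (0, x) + 1 := add_pos_of_nonneg_of_pos (F.nonneg _ _) one_pos
  have hev : ∀ᶠ q in 𝓝 ((0 : ℝ), x), σ q < σ (0, x) + 1 :=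
    hcont.continuousAt.eventually (gt_mem_nhds (lt_add_one _))
  rw [nhds_prod_eq, eventually_prod_iff] at hev
  obtain ⟨P, hP, Q, hQ, hPQ⟩ := hev
  obtain ⟨ε, hε, hPε⟩ := Metric.eventually_nhds_iff.1 hP
  refine ⟨_, hB, ε, hε, {y | Q y}, hQ, fun y hy s t hs ht hst => ?_⟩
  have hsmooth : ContMDiff 𝓘(ℝ, ℝ) 𝓘(ℝ, E) 1 fun u : ℝ => c (u, y) :=
    hc.comp (contMDiff_id.prodMk contMDiff_const)
  calc F.edist (c (s, y)) (c (t, y))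
      ≤ F.pathLength (fun u => c (u, y)) s t := by
        refine iInf_le_of_le s <| iInf_le_of_le t <| iInf_le_of_le (fun u => c (u, y)) <|
          iInf_le_of_le hst <| iInf_le_of_le ?_ <| iInf_le_of_le rfl <| iInf_le_of_le rfl le_rfl
        refine ⟨1, fun i => if i = 0 then s else t, ?_, by simp, by simp,
          fun i _ => hsmooth.contMDiffOn⟩
        exact monotone_nat_of_le_succ fun i => by by_cases hi : i = 0 <;> simp [hi, hst]
    _ ≤ ∫⁻ _ in Icc s t, ENNReal.ofReal (σ (0, x) + 1) := by
        refine setLIntegral_mono measurable_const fun u hu => ENNReal.ofReal_le_ofReal ?_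
        have hu' : |u| < ε := abs_lt.2
          ⟨(abs_lt.1 hs).1.trans_le hu.1, hu.2.trans_lt (abs_lt.1 ht).2⟩
        exact (hPQ (hPε (by simpa using hu')) hy).le
    _ = ENNReal.ofReal ((σ (0, x) + 1) * (t - s)) := by
        rw [setLIntegral_const, Real.volume_Icc, ← ENNReal.ofReal_mul hB.le]

/-- Under a `C^1` family of curves `t ↦ c (t, y)` with `c (0, y) = y`, the points `y` of a compact
set move with uniformly bounded speed at small times. -/
theorem IsLocallyLipschitzFinsler.exists_dist_le_mul_abs [MetricSpace M] [ChartedSpace E M]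
    [IsManifold 𝓘(ℝ, E) ∞ M] (hM : IsLocallyLipschitzFinsler E M) {c : ℝ × M → M}
    (hc : ContMDiff (𝓘(ℝ, ℝ).prod 𝓘(ℝ, E)) 𝓘(ℝ, E) 1 c) (hc0 : ∀ y, c (0, y) = y)
    {X : Set M} (hX : IsCompact X) :
    ∃ K : ℝ, ∃ ε > 0, ∀ y ∈ X, ∀ t, |t| < ε → dist (c (t, y)) y ≤ K * |t| := by
  refine hX.induction_on
    (p := fun X => ∃ K : ℝ, ∃ ε > 0, ∀ y ∈ X, ∀ t, |t| < ε → dist (c (t, y)) y ≤ K * |t|)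
    ⟨0, 1, one_pos, by simp⟩ (fun s t hst h => ?_) (fun s t h h' => ?_) (fun x _ => ?_)
  · obtain ⟨K, ε, hε, h⟩ := h
    exact ⟨K, ε, hε, fun y hy => h y (hst hy)⟩
  · obtain ⟨K, ε, hε, h⟩ := h
    obtain ⟨K', ε', hε', h'⟩ := h'
    refine ⟨max K K', min ε ε', lt_min hε hε', ?_⟩
    rintro y (hy | hy) t ht
    · refine (h y hy t (ht.trans_le (min_le_left _ _))).trans ?_
      gcongr
      exact le_max_left _ _
    · refine (h' y hy t (ht.trans_le (min_le_right _ _))).trans ?_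
      gcongr
      exact le_max_right _ _
  · obtain ⟨F, hF⟩ := hM
    obtain ⟨V, hV, k, _, hk, -, hkV⟩ := hF x
    obtain ⟨B, hB, ε, hε, U, hU, hBU⟩ := F.exists_edist_le hc x
    have hev : ∀ᶠ q in 𝓝 ((0 : ℝ), x), c q ∈ V :=
      hc.continuous.continuousAt (by rwa [hc0])
    rw [nhds_prod_eq, eventually_prod_iff] at hev
    obtain ⟨P, hP, Q, hQ, hPQ⟩ := hev
    obtain ⟨δ, hδ, hPδ⟩ := Metric.eventually_nhds_iff.1 hP
    refine ⟨_, mem_nhdsWithin_of_mem_nhds (inter_mem hU hQ), B / k,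
      min ε δ, lt_min hε hδ, fun y hy t ht => ?_⟩
    have hin : ∀ u : ℝ, |u| < min ε δ → c (u, y) ∈ V := fun u hu =>
      hPQ (hPδ (by simpa using hu.trans_le (min_le_right _ _))) hy.2
    have key : ∀ s t : ℝ, |s| < min ε δ → |t| < min ε δ → s ≤ t →
        dist (c (s, y)) (c (t, y)) ≤ B / k * (t - s) := fun s t hs ht hst => by
      have h := (hkV _ (hin s hs) _ (hin t ht)).1.trans (hBU y hy.1 s t
        (hs.trans_le (min_le_left _ _)) (ht.trans_le (min_le_left _ _)) hst)
      rw [ENNReal.ofReal_le_ofReal_iff (mul_nonneg hB.le (sub_nonneg.2 hst))] at h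
      rw [div_mul_eq_mul_div, le_div_iff₀ hk]
      linarith
    have h0 : |(0 : ℝ)| < min ε δ := by simpa using ⟨hε, hδ⟩
    rcases le_total 0 t with h | h
    · have := key 0 t h0 ht h
      rw [hc0, dist_comm] at this
      simpa [abs_of_nonneg h] using this
    · have := key t 0 ht h0 h
      rw [hc0] at this
      simpa [abs_of_nonpos h] using this

end Finsler

/-! ### The orbit in the space of translates -/

theorem hausdorffEDist_smul_le {G M : Type*} [PseudoMetricSpace M] [SMul G M] {X : Set M} {g : G}
    {r : ℝ} (h : ∀ y ∈ X, dist (g • y) y ≤ r) :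
    Metric.hausdorffEDist (g • X) X ≤ ENNReal.ofReal r := by
  refine Metric.hausdorffEDist_le_of_mem_edist ?_ fun y hy => ⟨g • y, smul_mem_smul_set hy, ?_⟩
  · rintro _ ⟨y, hy, rfl⟩
    exact ⟨y, hy, edist_dist (g • y) y ▸ ENNReal.ofReal_le_ofReal (h y hy)⟩
  · rw [edist_comm, edist_dist]
    exact ENNReal.ofReal_le_ofReal (h y hy)

theorem inducedHausdorff_mul_left {G M : Type*} [Group G] [MetricSpace M] [MulAction G M]
    (hisom : ∀ (g : G) (x y : M), dist (g • x) (g • y) = dist x y) (X : Set M) (k g h : G) :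
    inducedHausdorff G X ((k * g : G) : G ⧸ MulAction.stabilizer G X)
      ((k * h : G) : G ⧸ MulAction.stabilizer G X) = inducedHausdorff G X g h := by
  simp only [inducedHausdorff_mk, mul_smul]
  exact Metric.hausdorffEDist_image (Isometry.of_dist_eq (hisom k))

theorem mainTheorem10
    {EG : Type*} [NormedAddCommGroup EG] [NormedSpace ℝ EG] [FiniteDimensional ℝ EG]
    {EM : Type*} [NormedAddCommGroup EM] [NormedSpace ℝ EM] [FiniteDimensional ℝ EM]
    {G : Type*} [TopologicalSpace G] [T2Space G] [SecondCountableTopology G]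
    [ChartedSpace EG G] [Group G] [LieGroup 𝓘(ℝ, EG) ∞ G]
    {M : Type*} [MetricSpace M] [SecondCountableTopology M]
    [ChartedSpace EM M] [IsManifold 𝓘(ℝ, EM) ∞ M]
    (hM : IsLocallyLipschitzFinsler EM M)
    [MulAction G M]
    (hsmooth : ContMDiff (𝓘(ℝ, EG).prod 𝓘(ℝ, EM)) 𝓘(ℝ, EM) ∞ (fun q : G × M => q.1 • q.2))
    (hisom : ∀ (g : G) (x y : M), dist (g • x) (g • y) = dist x y)
    (X : Set M) (hX : IsCompact X)
    (v : GroupLieAlgebra 𝓘(ℝ, EG) G)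
    (η : ℝ → G ⧸ MulAction.stabilizer G X)
    (hη : ∀ t : ℝ, η t = (lieExp EG (t • v) : G)) :
    ∃ L : ℝ≥0∞, L < ⊤ ∧
      Tendsto (fun t : ℝ => inducedHausdorff G X (η t) ((1 : G) : G ⧸ MulAction.stabilizer G X) /
        ENNReal.ofReal |t|) (𝓝[≠] 0) (𝓝 L) ∧
      Tendsto (fun t : ℝ => Metric.hausdorffEDist ((lieExp EG (t • v) : G) • X) X /
        ENNReal.ofReal |t|) (𝓝[≠] 0) (𝓝 L) ∧
      Tendsto (fun t : ℝ => intrinsicDist (inducedHausdorff G X) (η t)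
        ((1 : G) : G ⧸ MulAction.stabilizer G X) / ENNReal.ofReal |t|) (𝓝[≠] 0) (𝓝 L) ∧
      curveLength (inducedHausdorff G X) η 0 1 = L ∧
      curveLength (intrinsicDist (inducedHausdorff G X)) η 0 1 = L := by
  have hfamily : ContMDiff (𝓘(ℝ, ℝ).prod 𝓘(ℝ, EM)) 𝓘(ℝ, EM) 1
      (fun q : ℝ × M => (lieExp EG (q.1 • v) : G) • q.2) :=
    (hsmooth.of_le (by simp)).comp
      (((contMDiff_lieExp_smul (G := G) v).comp contMDiff_fst).prodMk contMDiff_snd)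
  have hexp0 : (lieExp EG ((0 : ℝ) • v) : G) = 1 := (isMIntegralCurve_lieExp v).1
  have hη0 : η 0 = ((1 : G) : G ⧸ MulAction.stabilizer G X) := by rw [hη, hexp0]
  obtain ⟨K, ε, hε, hK⟩ :=
    hM.exists_dist_le_mul_abs hfamily (fun y => by simp only [hexp0, one_smul]) hX
  have hX1 : ∀ g : G, inducedHausdorff G X g ((1 : G) : G ⧸ MulAction.stabilizer G X) =
      Metric.hausdorffEDist (g • X) X := fun g => by rw [inducedHausdorff_mk, one_smul]
  obtain ⟨L, hL, h1, h2, h3, h4⟩ := exists_speed_of_homogeneous (d := inducedHausdorff G X)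
    (η := η) (fun _ => Metric.hausdorffEDist_self) (fun _ _ => Metric.hausdorffEDist_comm)
    (fun _ _ _ => Metric.hausdorffEDist_triangle)
    (fun s t => by
      have hs := lieExp_add_smul (G := G) v t (s - t)
      rw [add_sub_cancel] at hs
      have hinv := inducedHausdorff_mul_left hisom X (lieExp EG (t • v) : G)
        (lieExp EG ((s - t) • v)) 1
      rw [mul_one] at hinv
      rw [hη0, hη s, hη t, hη (s - t), hs]
      exact hinv)
    hε (C := K) (fun t ht => by
      rw [hη0, hη, hX1]
      exact hausdorffEDist_smul_le fun y hy => hK y hy t ht)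
  rw [hη0] at h1 h2
  refine ⟨L, hL, h1, ?_, h2, h3, h4⟩
  simpa only [hη, hX1] using h1
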